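/- Let $K\ge 1$. For a nonempty finite index set $I$ and positive parameters $\gamma=(\gamma_i)_{i\in I}$, let $\mathrm{Dir}(\gamma)$ be the Dirichlet distribution on the probability simplex of $\mathbb R^I$, i.e. the law of $\big(x_i/\sum_{j\in I} x_j\big)_{i\in I}$ for independent Gamma variables $x_i\sim\Gamma(\gamma_i,1)$. (1) Let $C=(c_{i,j})$ be a random real $K\times K$ matrix and let $\gamma$ be a $K\times K$ matrix with positive entries. Put $$a_i=\sum_{j=1}^K c_{i,j},\qquad b_{j|i}=\frac{c_{i,j}}{a_i}\qquad(1\le i,j\le K)$$ (with, say, $b_{j|i}=0$ where $a_i=0$). Then $C\sim\mathrm{Dir}(\gamma)$, as a random vector indexed by the $K^2$ pairs $(i,j)$, if and only if the following three conditions hold: (i) $a=(a_1,\dots,a_K)\sim\mathrm{Dir}\big((\sum_j\gamma_{i,j})_{1\le i\le K}\big)$; (ii) $b_{:|i}=(b_{1|i},\dots,b_{K|i})\sim\mathrm{Dir}(\gamma_{i,1},\dots,\gamma_{i,K})$ for every $i$; (iii) the $K+1$ random vectors $a,b_{:|1},\dots,b_{:|K}$ are mutually independent. (2) Consequently, if $a\sim\mathrm{Dir}(1,\dots,1)$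 and $b_{:|x}\sim\mathrm{Dir}(1/K,\dots,1/K)$, $1\le x\le K$, are mutually independent random vectors in $\mathbb R^K$ (the sparse prior), then the joint table $p(x,y)=a_x\,b_{y|x}$ has law $\mathrm{Dir}(1/K,\dots,1/K)$ on the probability simplex of $\mathbb R^{K^2}$. -/

import Mathlib

open MeasureTheory ProbabilityTheory

/-- The Dirichlet distribution `Dir(γ)` on the probability simplex of `ι → ℝ`, for a nonempty finite
index type `ι` and a vector `γ` of positive parameters: the law of `(x i / ∑ j, x j)ᵢ` where the
`x i` are independent Gamma variables with shape `γ i` and rate `1`. -/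
noncomputable def dirichletMeasure {ι : Type*} [Fintype ι] (γ : ι → ℝ) : Measure (ι → ℝ) :=
  (Measure.pi fun i => gammaMeasure (γ i) 1).map fun x i => x i / ∑ j, x j

/-- The vector `a` of row sums of a square matrix, `a i = ∑ j, c i j`. -/
def rowSum {K : ℕ} (c : Matrix (Fin K) (Fin K) ℝ) : Fin K → ℝ :=
  fun i => ∑ j, c i j

/-- The `i`-th row of a square matrix, normalized by its sum: `b_{j|i} = c i j / a i`. -/
noncomputable def rowCond {K : ℕ} (c : Matrix (Fin K) (Fin K) ℝ) (i : Fin K) : Fin K → ℝ :=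
  fun j => c i j / rowSum c i

/-- The sparse prior: the law of the joint probability table `p(x, y) = a x * b x y` when the
marginal `a ~ Dir(1, …, 1)` of the cause and the conditionals `b x ~ Dir(1/K, …, 1/K)` of the effect,
one for each value `x` of the cause, are drawn independently. -/
noncomputable def sparsePrior (K : ℕ) : Measure (Fin K × Fin K → ℝ) :=
  ((dirichletMeasure fun _ : Fin K => (1 : ℝ)).prod
    (Measure.pi fun _ : Fin K => dirichletMeasure fun _ : Fin K => (1 : ℝ) / (K : ℝ))).map
    fun ab p => ab.1 p.1 * ab.2 p.1 p.2

open scoped ENNReal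

/-! The core fact is that for independent Gamma variables the sum and the normalized vector are
independent (`map_sum_div_gammaPi`). Tilting the product law by `exp (t * ∑ x i)`, `t < 1`, and then
scaling by `1 - t` returns the same law up to a constant. Normalization ignores scaling, so on any
event about the normalized vector the Laplace transform of the sum is that of a Gamma law times the
probability of the event; uniqueness of the transform gives independence.

Applied to each row of a Gamma table, this gives independent Gamma row sums and Dirichlet normalized
rows. Dividing the table by its total normalizes the row sums and leaves the normalized rows
unchanged, which is the forward direction (`map_marginalCond_dirichletMeasure`). Multiplying back
recovers the table, as row sums are almost surely nonzero; this gives the converse, and the sparse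
prior is the case `γ = 1/K`, where row sums of `γ` are `1`. -/

lemma gammaPDF_mul_exp {a t : ℝ} (ha : 0 < a) (ht : t < 1) (x : ℝ) :
    gammaPDF a 1 x * ENNReal.ofReal (Real.exp (t * x)) =
      ENNReal.ofReal ((1 - t) ^ (-a)) *
        (ENNReal.ofReal |1 - t| * gammaPDF a 1 ((1 - t) * x)) := by
  have hs : 0 < 1 - t := by linarith
  have hG := Real.Gamma_pos_of_pos ha
  rcases lt_or_ge x 0 with hx | hx
  · rw [gammaPDF_of_neg hx, gammaPDF_of_neg (mul_neg_of_pos_of_neg hs hx)]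
    simp
  · rw [gammaPDF_of_nonneg hx, gammaPDF_of_nonneg (mul_nonneg hs.le hx), abs_of_pos hs,
      ← ENNReal.ofReal_mul hs.le, ← ENNReal.ofReal_mul (by positivity),
      ← ENNReal.ofReal_mul' (by positivity)]
    congr 1
    rw [Real.mul_rpow hs.le hx]
    have h1 : (1 - t) ^ (-a) * (1 - t) * (1 - t) ^ (a - 1) = 1 := by
      rw [← Real.rpow_add_one hs.ne', ← Real.rpow_add hs]
      simp
    have h2 : Real.exp (-(1 * x)) * Real.exp (t * x) = Real.exp (-(1 * ((1 - t) * x))) := by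
      rw [← Real.exp_add]
      ring_nf
    calc _ = 1 ^ a / Real.Gamma a * x ^ (a - 1) *
            (Real.exp (-(1 * x)) * Real.exp (t * x)) := by ring
      _ = ((1 - t) ^ (-a) * (1 - t) * (1 - t) ^ (a - 1)) *
            (1 ^ a / Real.Gamma a * x ^ (a - 1) * Real.exp (-(1 * ((1 - t) * x)))) := by
          rw [h1, h2]; ring
      _ = _ := by ring

lemma measurable_gammaPDF (a r : ℝ) : Measurable (gammaPDF a r) :=
  (measurable_gammaPDFReal a r).ennreal_ofReal

/-- Exponential tilting of a Gamma measure amounts to a rescaling. -/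
lemma lintegral_exp_mul_comp_mul_gammaMeasure {a t : ℝ} (ha : 0 < a) (ht : t < 1) {f : ℝ → ℝ≥0∞}
    (hf : Measurable f) :
    ∫⁻ x, ENNReal.ofReal (Real.exp (t * x)) * f ((1 - t) * x) ∂gammaMeasure a 1 =
      ENNReal.ofReal ((1 - t) ^ (-a)) * ∫⁻ x, f x ∂gammaMeasure a 1 := by
  have hs : 1 - t ≠ 0 := by linarith
  have hp := measurable_gammaPDF a 1
  rw [gammaMeasure, lintegral_withDensity_eq_lintegral_mul _ hp (by fun_prop),
    lintegral_withDensity_eq_lintegral_mul _ hp hf]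
  simp only [Pi.mul_apply, ← mul_assoc, gammaPDF_mul_exp ha ht]
  simp only [mul_assoc]
  rw [lintegral_const_mul _ (by fun_prop), lintegral_const_mul _ (by fun_prop)]
  -- Change of variables `x ↦ (1 - t) * x`, with Jacobian `|1 - t|`.
  conv_rhs => rw [← Real.smul_map_volume_mul_left hs]
  rw [lintegral_smul_measure, lintegral_map (by fun_prop) (by fun_prop), smul_eq_mul]

lemma ae_pos_gammaMeasure (a : ℝ) : ∀ᵐ x ∂gammaMeasure a 1, 0 < x := by
  rw [gammaMeasure, ae_withDensity_iff (measurable_gammaPDF a 1)]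
  filter_upwards [Measure.ae_ne volume (0 : ℝ)] with x hx h
  by_contra! hneg
  exact h (gammaPDF_of_neg (lt_of_le_of_ne hneg hx))

lemma lintegral_pi_prod {ι : Type*} [Fintype ι] {X : ι → Type*} [∀ i, MeasurableSpace (X i)]
    (μ : ∀ i, Measure (X i)) [∀ i, IsProbabilityMeasure (μ i)] {f : ∀ i, X i → ℝ≥0∞}
    (hf : ∀ i, Measurable (f i)) :
    ∫⁻ x, ∏ i, f i (x i) ∂Measure.pi μ = ∏ i, ∫⁻ x, f i x ∂μ i := by
  rw [lintegral_prod_eq_prod_lintegral_of_indepFun Finset.univ (fun i (x : ∀ i, X i) => f i (x i))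
    (iIndepFun_pi fun i => (hf i).aemeasurable) fun i => (hf i).comp (measurable_pi_apply i)]
  refine Finset.prod_congr rfl fun i _ => ?_
  exact (measurePreserving_eval μ i).lintegral_comp (hf i)

/-- The product of Gamma measures with shapes `γ i` and rate `1`. -/
noncomputable abbrev gammaPi {ι : Type*} [Fintype ι] (γ : ι → ℝ) : Measure (ι → ℝ) :=
  Measure.pi fun i => gammaMeasure (γ i) 1

section GammaPi

variable {ι : Type*} [Fintype ι] {γ : ι → ℝ}

lemma isProbabilityMeasure_gammaPi (hγ : ∀ i, 0 < γ i) : IsProbabilityMeasure (gammaPi γ) := by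
  have := fun i => isProbabilityMeasure_gammaMeasure (hγ i) one_pos
  infer_instance

lemma ae_pos_gammaPi (hγ : ∀ i, 0 < γ i) : ∀ᵐ x ∂gammaPi γ, ∀ i, 0 < x i := by
  have := fun i => isProbabilityMeasure_gammaMeasure (hγ i) one_pos
  rw [ae_all_iff]
  exact fun i => (Measure.tendsto_eval_ae_ae (i := i)).eventually (ae_pos_gammaMeasure (γ i))

/-- The exponential of the sum factors over coordinates, so on boxes this reduces to the
one-dimensional tilting identity. -/
lemma map_smul_withDensity_gammaPi (hγ : ∀ i, 0 < γ i) {t : ℝ} (ht : t < 1) :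
    ((gammaPi γ).withDensity fun x => ENNReal.ofReal (Real.exp (t * ∑ i, x i))).map
        (fun x => (1 - t) • x) =
      ENNReal.ofReal ((1 - t) ^ (-∑ i, γ i)) • gammaPi γ := by
  have hs : 0 < 1 - t := by linarith
  have := fun i => isProbabilityMeasure_gammaMeasure (hγ i) one_pos
  let c : ι → ℝ≥0∞ := fun i => ENNReal.ofReal ((1 - t) ^ (-γ i))
  have hfin (i : ι) : IsFiniteMeasure (c i • gammaMeasure (γ i) 1) :=
    Measure.smul_finite _ ENNReal.ofReal_ne_top
  have hc : ENNReal.ofReal ((1 - t) ^ (-∑ i, γ i)) = ∏ i, c i := by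
    rw [← ENNReal.ofReal_prod_of_nonneg fun i _ => by positivity, ← Finset.sum_neg_distrib,
      Real.rpow_sum_of_pos hs]
  trans Measure.pi fun i => c i • gammaMeasure (γ i) 1
  · refine (Measure.pi_eq fun s hms => ?_).symm
    have hm : Measurable fun x : ι → ℝ => (1 - t) • x := by fun_prop
    rw [Measure.map_apply hm (.univ_pi hms), withDensity_apply _ (hm (.univ_pi hms)),
      ← lintegral_indicator (hm (.univ_pi hms))]
    trans ∫⁻ x, ∏ i, (ENNReal.ofReal (Real.exp (t * x i)) *
      (s i).indicator 1 ((1 - t) * x i)) ∂gammaPi γ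
    · refine lintegral_congr fun x => ?_
      rw [Finset.prod_mul_distrib, ← ENNReal.ofReal_prod_of_nonneg fun i _ => by positivity,
        ← Real.exp_sum, ← Finset.mul_sum]
      by_cases hx : ∀ i, (1 - t) * x i ∈ s i
      · rw [Set.indicator_of_mem (by simpa [Set.mem_pi] using hx),
          Finset.prod_eq_one fun i _ => by simp [hx i], mul_one]
      · rw [Set.indicator_of_notMem (by simpa [Set.mem_pi] using hx)]
        push Not at hx
        obtain ⟨i, hi⟩ := hx
        rw [Finset.prod_eq_zero (Finset.mem_univ i) (by simp [hi]), mul_zero]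
    · have hmi (i : ι) : Measurable ((s i).indicator (1 : ℝ → ℝ≥0∞)) :=
        measurable_one.indicator (hms i)
      rw [lintegral_pi_prod (fun i => gammaMeasure (γ i) 1)
        (f := fun i y => ENNReal.ofReal (Real.exp (t * y)) * (s i).indicator 1 ((1 - t) * y))
        fun i => by have := hmi i; fun_prop]
      refine Finset.prod_congr rfl fun i _ => ?_
      rw [lintegral_exp_mul_comp_mul_gammaMeasure (hγ i) ht (hmi i), lintegral_indicator_one (hms i)]
      rfl
  · refine Measure.pi_eq fun s hms => ?_
    simp only [Measure.smul_apply, smul_eq_mul, Measure.pi_pi, Finset.prod_mul_distrib, hc]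

end GammaPi

/-! ### Laplace transforms characterizing Gamma laws -/

/-- On the half-line the transform is monotone in `t`, and its values at `1 - s` blow up as `s →
0+`. -/
lemma lintegral_exp_eq_top {m : Measure ℝ} (hm : ∀ᵐ x ∂m, 0 ≤ x) {g : ℝ} (hg : 0 < g)
    {c : ℝ≥0∞} (hc : c ≠ 0)
    (h : ∀ t < 1, ∫⁻ x, ENNReal.ofReal (Real.exp (t * x)) ∂m =
      ENNReal.ofReal ((1 - t) ^ (-g)) * c) {t : ℝ} (ht : 1 ≤ t) :
    ∫⁻ x, ENNReal.ofReal (Real.exp (t * x)) ∂m = ∞ := by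
  have hlim : Filter.Tendsto (fun s : ℝ => ENNReal.ofReal (s ^ (-g)) * c)
      (nhdsWithin 0 (Set.Ioi 0)) (nhds ∞) := by
    have h1 : Filter.Tendsto (fun s : ℝ => s ^ (-g)) (nhdsWithin 0 (Set.Ioi 0)) Filter.atTop :=
      tendsto_rpow_neg_nhdsGT_zero (by linarith)
    have := ENNReal.Tendsto.mul_const (b := c) (ENNReal.tendsto_ofReal_nhds_top.2 h1) (.inl ENNReal.top_ne_zero)
    rwa [ENNReal.top_mul hc] at this
  refine top_le_iff.1 (le_of_tendsto hlim ?_)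
  filter_upwards [self_mem_nhdsWithin] with s hs
  have := h (1 - s) (by simpa using hs)
  rw [sub_sub_cancel] at this
  rw [← this]
  refine lintegral_mono_ae ?_
  filter_upwards [hm] with x hx
  have hs' : 0 < s := hs
  gcongr
  linarith

lemma mgf_id_eq_toReal_lintegral (m : Measure ℝ) (t : ℝ) :
    mgf id m t = (∫⁻ x, ENNReal.ofReal (Real.exp (t * x)) ∂m).toReal := by
  rw [mgf, integral_eq_lintegral_of_nonneg_ae (.of_forall fun x => by positivity)
    (Measurable.aestronglyMeasurable (by fun_prop))]
  rfl

/-- A finite measure on the half-line whose Laplace transform is a multiple of that of a Gamma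
measure is a multiple of that measure. -/
lemma eq_smul_gammaMeasure_of_lintegral_exp {m : Measure ℝ} [IsFiniteMeasure m]
    (hm : ∀ᵐ x ∂m, 0 ≤ x) {a : ℝ} (ha : 0 < a) {c : ℝ≥0∞} (hc : c ≠ ∞)
    (h : ∀ t < 1, ∫⁻ x, ENNReal.ofReal (Real.exp (t * x)) ∂m =
      ENNReal.ofReal ((1 - t) ^ (-a)) * c) :
    m = c • gammaMeasure a 1 := by
  rcases eq_or_ne c 0 with rfl | hc0
  · have := h 0 one_pos
    simpa using this
  have := isProbabilityMeasure_gammaMeasure ha one_pos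
  have : IsFiniteMeasure (c • gammaMeasure a 1) := Measure.smul_finite _ hc
  have hm' : ∀ᵐ x ∂(c • gammaMeasure a 1), 0 ≤ x :=
    Measure.ae_smul_measure ((ae_pos_gammaMeasure a).mono fun _ hx => hx.le) c
  have h' (t : ℝ) (ht : t < 1) : ∫⁻ x, ENNReal.ofReal (Real.exp (t * x)) ∂(c • gammaMeasure a 1) =
      ENNReal.ofReal ((1 - t) ^ (-a)) * c := by
    have := lintegral_exp_mul_comp_mul_gammaMeasure ha ht (f := fun _ => 1) measurable_const
    simp only [mul_one, lintegral_const, measure_univ] at this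
    rw [lintegral_smul_measure, this, smul_eq_mul, mul_comm]
  -- Equality is needed at every real `t`; for `t ≥ 1` both integrals are infinite, so both `mgf`s
  -- take the default value `0`.
  have heq : mgf id m = mgf id (c • gammaMeasure a 1) := by
    funext t
    rw [mgf_id_eq_toReal_lintegral, mgf_id_eq_toReal_lintegral]
    rcases lt_or_ge t 1 with ht | ht
    · rw [h t ht, h' t ht]
    · rw [lintegral_exp_eq_top hm ha hc0 h ht, lintegral_exp_eq_top hm' ha hc0 h' ht]
  have hm0 : m ≠ 0 := by
    rintro rfl
    have := h 0 one_pos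
    simp [hc0.symm] at this
  have hmem : (0 : ℝ) ∈ interior (integrableExpSet id m) := by
    refine mem_interior.2 ⟨Set.Iio 1, fun t ht => ?_, isOpen_Iio, by simp⟩
    refine ⟨Measurable.aestronglyMeasurable (by fun_prop), ?_⟩
    rw [hasFiniteIntegral_iff_ofReal (.of_forall fun x => by positivity)]
    simp only [id]
    rw [h t ht]
    exact ENNReal.mul_lt_top ENNReal.ofReal_lt_top hc.lt_top
  refine Measure.ext_of_charFun (funext fun t => ?_)
  rw [← complexMGF_id_mul_I, ← complexMGF_id_mul_I]
  have hne : c • gammaMeasure a 1 ≠ 0 := by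
    intro h0
    have := congrArg (fun ν => ν Set.univ) h0
    simp [hc0] at this
  exact eqOn_complexMGF_of_mgf' heq (by simp [hm0, hne]) (by simpa using hmem)

/-! ### Independence of the sum and the normalized vector -/

lemma map_sum_restrict_gammaPi {ι : Type*} [Fintype ι] [Nonempty ι] {γ : ι → ℝ}
    (hγ : ∀ i, 0 < γ i) {s : Set (ι → ℝ)} (hs : MeasurableSet s) :
    ((gammaPi γ).restrict ((fun x i => x i / ∑ j, x j) ⁻¹' s)).map (fun x => ∑ i, x i) =
      dirichletMeasure γ s • gammaMeasure (∑ i, γ i) 1 := by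
  have := isProbabilityMeasure_gammaPi hγ
  have hN : Measurable fun (x : ι → ℝ) i => x i / ∑ j, x j := by fun_prop
  have hS : Measurable fun x : ι → ℝ => ∑ i, x i := by fun_prop
  rw [dirichletMeasure, Measure.map_apply hN hs]
  refine eq_smul_gammaMeasure_of_lintegral_exp ?_
    (Finset.sum_pos (fun i _ => hγ i) Finset.univ_nonempty) (measure_ne_top _ _) fun t ht => ?_
  · rw [ae_map_iff hS.aemeasurable measurableSet_Ici]
    exact ae_restrict_of_ae <| (ae_pos_gammaPi hγ).mono fun x hx =>
      Finset.sum_nonneg fun i _ => (hx i).le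
  · have ht' : 1 - t ≠ 0 := by linarith
    rw [lintegral_map (by fun_prop) hS, ← withDensity_apply _ (hN hs), ← smul_eq_mul,
      ← Measure.smul_apply, ← map_smul_withDensity_gammaPi hγ ht,
      Measure.map_apply (by fun_prop) (hN hs)]
    -- The event depends only on the normalized vector, hence is invariant under scaling by `1 - t`.
    congr 1
    ext x
    simp only [Set.mem_preimage, Pi.smul_apply, smul_eq_mul, ← Finset.mul_sum,
      mul_div_mul_left _ _ ht']

/-- For independent Gamma variables, the sum and the normalized vector are independent, with a Gamma
and a Dirichlet distribution respectively. -/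
lemma map_sum_div_gammaPi {ι : Type*} [Fintype ι] [Nonempty ι] {γ : ι → ℝ} (hγ : ∀ i, 0 < γ i) :
    (gammaPi γ).map (fun x => (∑ i, x i, fun i => x i / ∑ j, x j)) =
      (gammaMeasure (∑ i, γ i) 1).prod (dirichletMeasure γ) := by
  have := isProbabilityMeasure_gammaPi hγ
  have := isProbabilityMeasure_gammaMeasure
    (Finset.sum_pos (fun i _ => hγ i) Finset.univ_nonempty) one_pos
  have hN : Measurable fun (x : ι → ℝ) i => x i / ∑ j, x j := by fun_prop
  have hS : Measurable fun x : ι → ℝ => ∑ i, x i := by fun_prop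
  have : IsProbabilityMeasure (dirichletMeasure γ) := Measure.isProbabilityMeasure_map hN.aemeasurable
  refine (Measure.prod_eq fun s t hs ht => ?_).symm
  have h := congrArg (fun ν => ν s) (map_sum_restrict_gammaPi hγ ht)
  simp only [Measure.smul_apply, smul_eq_mul] at h
  rw [mul_comm, ← h, Measure.map_apply hS hs, Measure.restrict_apply (hS hs),
    Measure.map_apply (hS.prodMk hN) (hs.prod ht)]
  rfl

section Dirichlet

variable {ι : Type*} [Fintype ι] {γ : ι → ℝ}

lemma measurable_div_sum : Measurable fun (x : ι → ℝ) i => x i / ∑ j, x j := by fun_prop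

lemma isProbabilityMeasure_dirichletMeasure (hγ : ∀ i, 0 < γ i) :
    IsProbabilityMeasure (dirichletMeasure γ) := by
  have := isProbabilityMeasure_gammaPi hγ
  exact Measure.isProbabilityMeasure_map measurable_div_sum.aemeasurable

lemma ae_pos_dirichletMeasure [Nonempty ι] (hγ : ∀ i, 0 < γ i) :
    ∀ᵐ x ∂dirichletMeasure γ, ∀ i, 0 < x i := by
  have hms : MeasurableSet {x : ι → ℝ | ∀ i, 0 < x i} := by
    rw [Set.ofPred_forall]
    exact .iInter fun i => measurableSet_lt measurable_const (measurable_pi_apply i)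
  rw [dirichletMeasure, ae_map_iff measurable_div_sum.aemeasurable hms]
  filter_upwards [ae_pos_gammaPi hγ] with x hx i
  exact div_pos (hx i) (Finset.sum_pos (fun j _ => hx j) Finset.univ_nonempty)

end Dirichlet

lemma measurable_optionElim {ι α : Type*} [MeasurableSpace α] :
    Measurable fun (ab : α × (ι → α)) (k : Option ι) => k.elim ab.1 ab.2 := by
  refine measurable_pi_lambda _ fun k => ?_
  cases k <;> dsimp <;> fun_prop

lemma pi_map_optionElim {ι α : Type*} [Fintype ι] [MeasurableSpace α] (μ : Measure α)
    (ν : ι → Measure α) [SigmaFinite μ] [∀ i, SigmaFinite (ν i)] :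
    (μ.prod (Measure.pi ν)).map (fun ab (k : Option ι) => k.elim ab.1 ab.2) =
      Measure.pi fun k : Option ι => k.elim μ ν := by
  have hsf (k : Option ι) : SigmaFinite (k.elim μ ν) := by cases k <;> dsimp <;> infer_instance
  refine (Measure.pi_eq fun s hs => ?_).symm
  rw [Measure.map_apply measurable_optionElim (.univ_pi hs), Fintype.prod_option]
  dsimp only [Option.elim]
  rw [← Measure.pi_pi, ← Measure.prod_prod]
  congr 1
  ext ab
  simp [Set.mem_pi, Option.forall]

lemma pi_map_curry {ι κ α : Type*} [Fintype ι] [Fintype κ] [MeasurableSpace α]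
    (μ : ι → κ → Measure α) [∀ i j, IsProbabilityMeasure (μ i j)] :
    (Measure.pi fun p : ι × κ => μ p.1 p.2).map Function.curry =
      Measure.pi fun i => Measure.pi (μ i) := by
  have := Measure.infinitePi_map_curry μ
  simpa only [Measure.infinitePi_eq_pi, MeasurableEquiv.coe_curry] using this

/-! ### Row sums and normalized rows of a Dirichlet table -/

section Table

variable {K : ℕ} {γ : Matrix (Fin K) (Fin K) ℝ}

/-- The row sums of a table together with its normalized rows. -/
noncomputable def marginalCond (x : Fin K × Fin K → ℝ) (k : Option (Fin K)) : Fin K → ℝ :=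
  k.elim (rowSum (Function.curry x)) (rowCond (Function.curry x))

/-- The table with prescribed row sums and normalized rows. -/
def tableOfMarginalCond (z : Option (Fin K) → Fin K → ℝ) (p : Fin K × Fin K) : ℝ :=
  z none p.1 * z (some p.1) p.2

/-- The joint law of independent Dirichlet row sums and normalized rows. -/
noncomputable def marginalCondLaw (γ : Matrix (Fin K) (Fin K) ℝ) :
    Measure (Option (Fin K) → Fin K → ℝ) :=
  Measure.pi fun k : Option (Fin K) =>
    k.elim (dirichletMeasure (rowSum γ)) fun i => dirichletMeasure (γ i)

lemma measurable_marginalCond : Measurable (marginalCond (K := K)) := by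
  refine measurable_pi_lambda _ fun k => measurable_pi_lambda _ fun i => ?_
  cases k <;> simp only [marginalCond, Option.elim, rowSum, rowCond, Function.curry] <;> fun_prop

lemma measurable_tableOfMarginalCond : Measurable (tableOfMarginalCond (K := K)) := by
  unfold tableOfMarginalCond
  fun_prop

lemma tableOfMarginalCond_elim {c : Matrix (Fin K) (Fin K) ℝ} (hc : ∀ i, rowSum c i ≠ 0) :
    tableOfMarginalCond (fun k => k.elim (rowSum c) (rowCond c)) = fun p => c p.1 p.2 := by
  funext p
  simp only [tableOfMarginalCond, Option.elim, rowCond]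
  exact mul_div_cancel₀ _ (hc p.1)

lemma rowSum_pos (hK : 0 < K) (hγ : ∀ i j, 0 < γ i j) (i : Fin K) : 0 < rowSum γ i :=
  have : NeZero K := ⟨hK.ne'⟩
  Finset.sum_pos (fun j _ => hγ i j) Finset.univ_nonempty

lemma map_marginalCond_dirichletMeasure (hK : 0 < K) (hγ : ∀ i j, 0 < γ i j) :
    (dirichletMeasure fun p : Fin K × Fin K => γ p.1 p.2).map marginalCond =
      marginalCondLaw γ := by
  have : NeZero K := ⟨hK.ne'⟩
  have hR := rowSum_pos hK hγ
  have := fun i j => isProbabilityMeasure_gammaMeasure (hγ i j) one_pos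
  have := fun i => isProbabilityMeasure_gammaMeasure (hR i) one_pos
  have := fun i => isProbabilityMeasure_dirichletMeasure (hγ i)
  have := isProbabilityMeasure_dirichletMeasure hR
  let f : (Fin K → ℝ) → ℝ × (Fin K → ℝ) := fun x => (∑ i, x i, fun i => x i / ∑ j, x j)
  have hf : Measurable f := by fun_prop
  have hrow (i : Fin K) : (gammaPi (γ i)).map f =
      (gammaMeasure (rowSum γ i) 1).prod (dirichletMeasure (γ i)) := map_sum_div_gammaPi (hγ i)
  have hrows : (Measure.pi fun i => gammaPi (γ i)).map (fun x i => f (x i)) =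
      Measure.pi fun i => (gammaMeasure (rowSum γ i) 1).prod (dirichletMeasure (γ i)) := by
    have (i : Fin K) : IsProbabilityMeasure ((gammaPi (γ i)).map f) := by
      rw [hrow]
      infer_instance
    rw [Measure.pi_map_pi fun i => hf.aemeasurable]
    simp_rw [hrow]
  have hcurry : Measurable (Function.curry : (Fin K × Fin K → ℝ) → Fin K → Fin K → ℝ) :=
    (MeasurableEquiv.curry (Fin K) (Fin K) ℝ).measurable
  have hnorm := (measurable_div_sum (ι := Fin K)).prodMap
    (measurable_id (α := Fin K → Fin K → ℝ))
  have hf' : Measurable fun (x : Fin K → Fin K → ℝ) i => f (x i) := by fun_prop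
  have harrow := measurePreserving_arrowProdEquivProdArrow ℝ (Fin K → ℝ) (Fin K)
    (fun i => gammaMeasure (rowSum γ i) 1) (fun i => dirichletMeasure (γ i))
  rw [marginalCondLaw, ← pi_map_optionElim]
  -- Only the law of the row sums is unfolded into normalized Gammas, so that both sides become
  -- images of one Gamma table.
  conv_rhs => rw [← Measure.map_id (μ := Measure.pi fun i => dirichletMeasure (γ i)),
    dirichletMeasure]
  rw [Measure.map_prod_map _ _ measurable_div_sum measurable_id, ← harrow.map_eq, ← hrows,
    ← pi_map_curry fun i j => gammaMeasure (γ i j) 1, dirichletMeasure,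
    Measure.map_map hf' hcurry, Measure.map_map harrow.measurable (hf'.comp hcurry),
    Measure.map_map hnorm (harrow.measurable.comp (hf'.comp hcurry)),
    Measure.map_map measurable_optionElim
      (hnorm.comp (harrow.measurable.comp (hf'.comp hcurry))),
    Measure.map_map measurable_marginalCond measurable_div_sum]
  refine Measure.map_congr ?_
  filter_upwards [ae_pos_gammaPi (γ := fun p : Fin K × Fin K => γ p.1 p.2) fun p => hγ p.1 p.2]
    with x hx
  have hT : (∑ p, x p) ≠ 0 := (Finset.sum_pos (fun p _ => hx p) Finset.univ_nonempty).ne'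
  funext k i
  cases k with
  | none =>
    change ∑ j, x (i, j) / ∑ p, x p = (∑ j, x (i, j)) / ∑ i, ∑ j, x (i, j)
    rw [← Finset.sum_div, Fintype.sum_prod_type]
  | some l =>
    change x (l, i) / (∑ p, x p) / (∑ j, x (l, j) / ∑ p, x p) = x (l, i) / ∑ j, x (l, j)
    rw [← Finset.sum_div, div_div_div_cancel_right₀ hT]

lemma map_tableOfMarginalCond_marginalCondLaw (hK : 0 < K) (hγ : ∀ i j, 0 < γ i j) :
    (marginalCondLaw γ).map tableOfMarginalCond =
      dirichletMeasure fun p : Fin K × Fin K => γ p.1 p.2 := by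
  have : NeZero K := ⟨hK.ne'⟩
  rw [← map_marginalCond_dirichletMeasure hK hγ,
    Measure.map_map measurable_tableOfMarginalCond measurable_marginalCond]
  conv_rhs => rw [← Measure.map_id (μ := dirichletMeasure _)]
  refine Measure.map_congr ?_
  filter_upwards [ae_pos_dirichletMeasure (γ := fun p : Fin K × Fin K => γ p.1 p.2)
    fun p => hγ p.1 p.2] with x hx
  exact tableOfMarginalCond_elim (c := Function.curry x)
    fun i => (rowSum_pos (γ := Function.curry x) hK (fun i j => hx (i, j)) i).ne'

end Table

theorem mainTheorem3 (K : ℕ) (hK : 0 < K) :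
    (∀ (Ω : Type*) [MeasurableSpace Ω] (P : Measure Ω) [IsProbabilityMeasure P]
        (C : Ω → Matrix (Fin K) (Fin K) ℝ) (_hC : ∀ i j, AEMeasurable (fun ω => C ω i j) P)
        (γ : Matrix (Fin K) (Fin K) ℝ) (_hγ : ∀ i j, 0 < γ i j),
        HasLaw (fun ω (p : Fin K × Fin K) => C ω p.1 p.2)
            (dirichletMeasure fun p : Fin K × Fin K => γ p.1 p.2) P ↔
          HasLaw (fun ω => rowSum (C ω)) (dirichletMeasure (rowSum γ)) P ∧
          (∀ i, HasLaw (fun ω => rowCond (C ω) i) (dirichletMeasure (γ i)) P) ∧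
          iIndepFun (fun (k : Option (Fin K)) ω => k.elim (rowSum (C ω)) (rowCond (C ω))) P) ∧
    sparsePrior K = dirichletMeasure fun _ : Fin K × Fin K => (1 : ℝ) / (K : ℝ) := by
  have : NeZero K := ⟨hK.ne'⟩
  refine ⟨fun Ω _ P _ C _ γ hγ => ?_, ?_⟩
  · have := fun i => isProbabilityMeasure_dirichletMeasure (hγ i)
    have hR := rowSum_pos hK hγ
    have := isProbabilityMeasure_dirichletMeasure hR
    let m : Option (Fin K) → Measure (Fin K → ℝ) := fun k =>
      k.elim (dirichletMeasure (rowSum γ)) fun i => dirichletMeasure (γ i)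
    have (k : Option (Fin K)) : IsProbabilityMeasure (m k) := by
      cases k <;> dsimp [m] <;> infer_instance
    constructor
    · intro h
      have hE : HasLaw marginalCond (marginalCondLaw γ)
          (dirichletMeasure fun p : Fin K × Fin K => γ p.1 p.2) :=
        ⟨measurable_marginalCond.aemeasurable, map_marginalCond_dirichletMeasure hK hγ⟩
      have hjoint : HasLaw (fun ω (k : Option (Fin K)) => k.elim (rowSum (C ω)) (rowCond (C ω)))
          (Measure.pi m) P := hE.fun_comp h
      have hk (k : Option (Fin K)) :
          HasLaw (fun ω => k.elim (rowSum (C ω)) (rowCond (C ω))) (m k) P :=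
        (measurePreserving_eval m k).hasLaw.fun_comp hjoint
      exact ⟨hk none, fun i => hk (some i), (iIndepFun_iff_hasLaw_pi_pi hk).2 hjoint⟩
    · rintro ⟨ha, hb, hind⟩
      have hk (k : Option (Fin K)) :
          HasLaw (fun ω => k.elim (rowSum (C ω)) (rowCond (C ω))) (m k) P := by
        cases k with
        | none => exact ha
        | some i => exact hb i
      have hG : HasLaw tableOfMarginalCond
          (dirichletMeasure fun p : Fin K × Fin K => γ p.1 p.2) (Measure.pi m) :=
        ⟨measurable_tableOfMarginalCond.aemeasurable,
          map_tableOfMarginalCond_marginalCondLaw hK hγ⟩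
      refine (hG.fun_comp (hind.hasLaw_pi hk)).congr ?_
      -- Condition (i) alone makes all row sums almost surely positive, so the division defining the
      -- normalized rows can be undone.
      have hpos := ae_pos_dirichletMeasure hR
      rw [← ha.map_eq] at hpos
      filter_upwards [ae_of_ae_map ha.aemeasurable hpos] with ω hω
      exact (tableOfMarginalCond_elim fun i => (hω i).ne').symm
  · have hK' : (0 : ℝ) < 1 / K := by positivity
    let γ : Matrix (Fin K) (Fin K) ℝ := fun _ _ => 1 / K
    have hsum : rowSum γ = fun _ => 1 := by
      funext i
      simp [rowSum, γ]
    have := isProbabilityMeasure_dirichletMeasure fun _ : Fin K => hK'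
    have := isProbabilityMeasure_dirichletMeasure fun _ : Fin K => one_pos (α := ℝ)
    have h := map_tableOfMarginalCond_marginalCondLaw (γ := γ) hK fun _ _ => hK'
    rw [marginalCondLaw, hsum, ← pi_map_optionElim,
      Measure.map_map measurable_tableOfMarginalCond measurable_optionElim] at h
    exact h
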